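/- Let $G$ be a finite connected graph with vertex set $V(G)\neq\emptyset$ and edge set $E(G)$, where self-edges and parallel edges are allowed, and let each edge $e$ carry a weight $w(e)>0$. For a vertex $v$ let $d(v)$ be the sum of the weights of all edges incident to $v$ (a self-edge being counted once). A spanning tree of $G$ is a set $t\subseteq E(G)$ such that the graph with vertex set $V(G)$ and edge set $t$ is connected and has no cycles (self-edges and pairs of parallel edges are cycles); its weight is $w(t)=\prod_{e\in t}w(e)$. Let $x\in V(G)$. A weighted random walk on $G$ from $x$ consists of random vertices $X_0,X_1,X_2,\dots$ and random edges $Y_0,Y_1,Y_2,\dots$ ($Y_k$ being the edge travelled from $X_k$ to $X_{k+1}$) on a probability space, such that for all $n\ge 0$, all vertices $v_0,\dots,v_n$ and all edges $e_0,\dots,e_{n-1}$ $$\mathbf P\bigl(X_i=v_i\ (0\le i\le n),\ Y_i=e_i\ (0\le i<n)\bigr)=\prod_{i=0}^{n-1}\frac{w(e_i)}{d(v_i)}$$ if $v_0=x$ and $e_i$ connects $v_i$ to $v_{i+1}$ for every $i<n$, and the probability is $0$ otherwise. The groundskeeper's algorithm (Aldous–Broder) keeps, for each newly visited vertex, the edge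 by which it was first entered, oriented from the new vertex back to the old one. Let $\mathbf T$ be the random set of edges obtained by ignoring the orientations, i.e. $\mathbf T=\{Y_k : k\ge 0,\ X_{k+1}\notin\{X_0,\dots,X_k\}\}$. Then $\mathbf T$ is almost surely a spanning tree of $G$, and it has the weight-selected distribution: for every spanning tree $t$ of $G$, $$\mathbf P(\mathbf T=t)=\frac{\prod_{e\in t}w(e)}{\sum_{u}\prod_{e\in u}w(e)},$$ where $u$ ranges over all spanning trees of $G$. In particular, if all weights are equal to $1$ (so that the walk is simple random walk), then $\mathbf T$ is uniformly distributed over the spanning trees of $G$. -/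

import Mathlib

open scoped Graph
open MeasureTheory

noncomputable section

namespace Graph

variable {α β : Type*}

/-- `G` is connected: it has a vertex, and any two vertices are joined by a path of edges. -/
def Connected (G : Graph α β) : Prop :=
  V(G).Nonempty ∧ ∀ u ∈ V(G), ∀ v ∈ V(G), Relation.ReflTransGen G.Adj u v

/-- `G` has no cycles. A cycle consists of `n + 1 ≥ 1` distinct vertices `v 0, …, v n` and
distinct edges `e 0, …, e n`, where `e i` connects `v i` to `v (i + 1)`, indices being taken
modulo `n + 1` (the addition of `Fin (n + 1)`). Self-edges (`n = 0`) and pairs of parallel edges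
(`n = 1`) are cycles. -/
def Acyclic (G : Graph α β) : Prop :=
  ¬ ∃ (n : ℕ) (v : Fin (n + 1) → α) (e : Fin (n + 1) → β),
    Function.Injective v ∧ Function.Injective e ∧ ∀ i, G.IsLink (e i) (v i) (v (i + 1))

/-- A set `t` of edges of `G` is (the edge set of) a spanning tree: the subgraph of `G` with all
the vertices of `G` and with edge set `t` is connected and has no cycles. -/
def IsSpanningTree (G : Graph α β) (t : Set β) : Prop :=
  t ⊆ E(G) ∧ (G.restrict t).Connected ∧ (G.restrict t).Acyclic

/-- The sum `d(v)` of the weights of all edges incident to `v` (a self-edge counts once). -/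
def weightedDegree (G : Graph α β) (w : β → ℝ) (v : α) : ℝ :=
  ∑ᶠ e ∈ G.incidenceSet v, w e

open Classical in
/-- The probability that the weighted random walk, when at `v`, walks along `e` and so gets to
`u`: it is `w e / d(v)` if `e` connects `v` to `u`, and `0` otherwise. -/
def stepProb (G : Graph α β) (w : β → ℝ) (v : α) (e : β) (u : α) : ℝ :=
  if G.IsLink e v u then w e / G.weightedDegree w v else 0

open Classical in
/-- `(X, Y)` is a weighted random walk on `G` from `x`, where `X n` is the position at time `n`
and `Y n` is the edge travelled between times `n` and `n + 1`; it is defined through its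
finite-dimensional marginals. -/
structure IsWeightedRandomWalk (G : Graph α β) (w : β → ℝ) (x : V(G))
    {Ω : Type*} [MeasurableSpace Ω] (P : Measure Ω)
    (X : ℕ → Ω → V(G)) (Y : ℕ → Ω → E(G)) : Prop where
  measurableSet_position : ∀ n v, MeasurableSet {ω | X n ω = v}
  measurableSet_edge : ∀ n e, MeasurableSet {ω | Y n ω = e}
  marginal : ∀ (n : ℕ) (v : ℕ → V(G)) (e : ℕ → E(G)),
    P {ω | (∀ i ≤ n, X i ω = v i) ∧ ∀ i < n, Y i ω = e i} =
      if v 0 = x then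
        ∏ i ∈ Finset.range n, ENNReal.ofReal (G.stepProb w (v i) (e i) (v (i + 1)))
      else 0

/-- The weight of a spanning tree: the product of the weights of its edges. -/
def treeWeight (w : β → ℝ) (t : Set β) : ℝ := ∏ᶠ e ∈ t, w e

/-- The probability of the spanning tree `t` under the weight-selected distribution. -/
def weightSelectedProb (G : Graph α β) (w : β → ℝ) (t : Set β) : ℝ :=
  treeWeight w t / ∑ᶠ u ∈ {u : Set β | G.IsSpanningTree u}, treeWeight w u

/-- The groundskeeper's algorithm applied to the walk that visits `y 0, y 1, …` and travels along
`f k` from `y k` to `y (k + 1)`. The output is the set of chalked arrows, an arrow `(e, z, v)`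
being an edge `e` oriented from the new vertex `z` back to the old one `v`: the edge `f k` is
chalked exactly if `y (k + 1)` is then visited for the first time. -/
def groundskeeper (y : ℕ → α) (f : ℕ → β) : Set (β × α × α) :=
  {a | ∃ k, a = (f k, y (k + 1), y k) ∧ ∀ j ≤ k, y j ≠ y (k + 1)}

/-- The edges chalked by the groundskeeper, the arrows being ignored. -/
def groundskeeperTree (y : ℕ → α) (f : ℕ → β) : Set β :=
  Prod.fst '' groundskeeper y f

end Graph

end

/-! Fix a spanning tree `t` and let `Z` be the total weight of all spanning trees. Pretend that the
first-entrance arrows of the walk from `X n` onwards form an arborescence rooted at `X n`, chosen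
with probability proportional to weight. Prepending the actual first `n` steps overwrites some of
its arrows by earlier entrances. The total weight `M n` of the arborescences for which the result
has edge set `t` is a martingale (`arrowMartingale`).

The reason is `sum_rootedSum_update`. Weight a system of arrows by all of them, also the one at the
root, and divide by the degree of the root afterwards. A step from `y` to `z` along `e` moves the
root to `z` and sets the arrow at `z` to `(e, y)`. Arrows rooted at `y`, with the one at `y`
included, have a single cycle; it passes through `y`, and the predecessor of `y` on it is the only
`z` that can give rise to them. As `e` weighs the same in both directions (`arrowWeight_comm`), this
matches the step probabilities exactly.

Almost surely `M 0` is the weight of `t`, because a spanning tree is the edge set of exactly one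
arborescence with a given root, up to the arrow at the root (`rootedSum_arrowEdges_eq`). Once every
vertex has been visited, all relevant arrows are overwritten, so `M n = Z` on the event `T = t`.
Markov's inequality and almost sure covering give `Z * P (T = t) ≤ w(t)`. Since `T` is almost surely
a spanning tree, both sides sum to `Z` over all `t`, which forces equality. -/

noncomputable section

/-! ### Systems of arrows and moving their root -/

namespace Arrows

open Function

variable {V E : Type*}

/-- `a` assigns an outgoing arrow `(e, u)` to every vertex. It is rooted at `r` if following the
arrows leads from every vertex to `r`. The arrow at `r` itself is irrelevant. -/
def IsRootedAt (a : V → E × V) (r : V) : Prop :=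
  ∀ v, ∃ n, (fun u => (a u).2)^[n] v = r

/-- Together with `IsRootedAt.exists_rank` (rank = number of steps to the root), this turns
arguments about following arrows into inductions and comparisons of natural numbers. -/
lemma isRootedAt_of_rank {a : V → E × V} {r : V} (k : V → ℕ)
    (hk : ∀ v, v ≠ r → k (a v).2 < k v) : IsRootedAt a r := by
  intro v
  induction h : k v using Nat.strong_induction_on generalizing v with
  | _ m ih =>
    by_cases hv : v = r
    · exact ⟨0, hv⟩
    · obtain ⟨n, hn⟩ := ih _ (h ▸ hk v hv) _ rfl
      exact ⟨n + 1, hn⟩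

open Classical in
lemma IsRootedAt.exists_rank {a : V → E × V} {r : V} (h : IsRootedAt a r) :
    ∃ k : V → ℕ, ∀ v, v ≠ r → k (a v).2 < k v := by
  refine ⟨fun v => Nat.find (h v), fun v hv => ?_⟩
  have h₁ := Nat.find_spec (h v)
  rcases h₂ : Nat.find (h v) with _ | n
  · rw [h₂] at h₁
    exact absurd h₁ hv
  · rw [h₂] at h₁
    change _ < Nat.find (h v)
    rw [h₂]
    exact Nat.lt_succ_of_le (Nat.find_min' (h (a v).2) h₁)

section Update

variable [DecidableEq V]

lemma IsRootedAt.update {a : V → E × V} {r : V} (h : IsRootedAt a r) (s : E × V) :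
    IsRootedAt (update a r s) r := by
  obtain ⟨k, hk⟩ := h.exists_rank
  exact isRootedAt_of_rank k fun v hv => by simpa [update_of_ne hv] using hk v hv

lemma isRootedAt_update_iff {a : V → E × V} {r : V} {s : E × V} :
    IsRootedAt (Function.update a r s) r ↔ IsRootedAt a r :=
  ⟨fun h => by simpa using h.update (a r), fun h => h.update s⟩

end Update

lemma IsRootedAt.snd {a : V → E × V} {z : V} (h : IsRootedAt a z) : IsRootedAt a (a z).2 := by
  intro v
  obtain ⟨n, hn⟩ := h v
  exact ⟨n + 1, by rw [iterate_succ_apply', hn]⟩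

/-- The arrows rooted at `y` together with the arrow at `y` form a graph with one cycle, which
passes through `y`; the predecessor of `y` on it is the only other admissible root with an arrow
to `y`. -/
lemma IsRootedAt.existsUnique_pred {a : V → E × V} {y : V} (h : IsRootedAt a y) :
    ∃! z, IsRootedAt a z ∧ (a z).2 = y := by
  set p : V → V := fun u => (a u).2 with hp
  obtain ⟨n, hn⟩ := h (p y)
  refine ⟨p^[n] y, ⟨fun v => ?_, ?_⟩, ?_⟩
  · obtain ⟨m, hm⟩ := h v
    exact ⟨n + m, by rw [iterate_add_apply, hm]⟩
  · change p (p^[n] y) = y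
    rw [← iterate_succ_apply' p, iterate_succ_apply]
    exact hn
  -- Uniqueness: `y` is periodic, every admissible root lies on its orbit and so is periodic too,
  -- and `p` is injective on periodic points.
  · have hy : y ∈ periodicPts p := mk_mem_periodicPts (n := n + 1) (Nat.succ_pos _) hn
    have key : ∀ z, IsRootedAt a z → z ∈ periodicPts p := by
      intro z hz
      obtain ⟨m, hm⟩ := hz y
      rw [← hm]
      exact (bijOn_periodicPts p).mapsTo.iterate m hy
    rintro z ⟨hz, hzy⟩
    refine (bijOn_periodicPts p).injOn (key z hz) (key _ fun v => ?_) ?_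
    · obtain ⟨m, hm⟩ := h v
      exact ⟨n + m, by rw [iterate_add_apply, hm]⟩
    · rw [← iterate_succ_apply' p, iterate_succ_apply]
      exact hzy.trans hn.symm

section Sum

open scoped ENNReal
open scoped Classical

variable [Fintype V] (c : V → E × V → ℝ≥0∞)

lemma prod_mul_eq_prod_update_mul (a : V → E × V) (z : V) (s : E × V) :
    (∏ v, c v (a v)) * c z s = (∏ v, c v (update a z s v)) * c z (a z) := by
  have h : ∏ v ∈ Finset.univ.erase z, c v (update a z s v) =
      ∏ v ∈ Finset.univ.erase z, c v (a v) :=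
    Finset.prod_congr rfl fun v hv => by rw [update_of_ne (Finset.ne_of_mem_erase hv)]
  rw [← Finset.mul_prod_erase _ _ (Finset.mem_univ z),
    ← Finset.mul_prod_erase _ (fun v => c v (update a z s v)) (Finset.mem_univ z),
    update_self, h]
  ring

variable [Fintype E]

/-- The sum of `φ` over all systems of arrows rooted at `r`, weighted by the product of the
weights of the arrows (including the irrelevant one at `r`). -/
def rootedSum (r : V) (φ : (V → E × V) → ℝ≥0∞) : ℝ≥0∞ :=
  ∑ a, if IsRootedAt a r then (∏ v, c v (a v)) * φ a else 0

/-- Resampling the arrow at the root. -/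
lemma sum_mul_rootedSum (z : V) (φ : (V → E × V) → ℝ≥0∞) :
    (∑ s, c z s) * rootedSum c z φ =
      ∑ s, c z s * rootedSum c z (fun a => φ (update a z s)) := by
  -- Exchanging the fresh arrow with the one at the root is an involution that preserves both
  -- rootedness and the total weight.
  let σ : Equiv.Perm ((E × V) × (V → E × V)) := Involutive.toPerm
    (fun q => (q.2 z, update q.2 z q.1)) (fun q => by simp)
  simp only [rootedSum, Finset.mul_sum, Finset.sum_mul]
  rw [Finset.sum_comm, ← Fintype.sum_prod_type', ← Fintype.sum_prod_type', ← Equiv.sum_comp σ]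
  refine Finset.sum_congr rfl fun q _ => ?_
  change c z (q.2 z) * (if IsRootedAt (update q.2 z q.1) z then _ else 0) = _
  rw [isRootedAt_update_iff]
  split_ifs with h
  · rw [← mul_assoc, ← mul_assoc, mul_comm (c z q.1), prod_mul_eq_prod_update_mul, mul_comm (c z _)]
    rfl
  · simp

/-- The weight of systems of arrows is invariant under moving the root from `z` to `y` and
reversing the travelled arrow. -/
lemma sum_rootedSum_update (hc₀ : ∀ z, ∑ s, c z s ≠ 0) (hc : ∀ z, ∑ s, c z s ≠ ⊤) (y : V)
    (φ : (V → E × V) → ℝ≥0∞) :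
    ∑ z, ∑ e, c z (e, y) / (∑ s, c z s) * rootedSum c z (fun a => φ (update a z (e, y))) =
      rootedSum c y φ := by
  -- Averaging over a resampled root arrow, restricted to arrows pointing at `y`, only restricts the
  -- original sum to systems whose root arrow points at `y`.
  have h₁ : ∀ z, ∑ e, c z (e, y) / (∑ s, c z s) *
      rootedSum c z (fun a => φ (update a z (e, y))) =
        rootedSum c z (fun a => if (a z).2 = y then φ a else 0) := by
    intro z
    refine (ENNReal.mul_right_inj (hc₀ z) (hc z)).1 ?_
    rw [sum_mul_rootedSum, Finset.mul_sum]
    conv_rhs => rw [Fintype.sum_prod_type]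
    refine Finset.sum_congr rfl fun e _ => ?_
    rw [Finset.sum_eq_single y]
    · rw [← mul_assoc, ENNReal.mul_div_cancel (hc₀ z) (hc z)]
      simp
    · intro u _ hu
      simp [hu, rootedSum]
    · simp
  simp only [h₁]
  simp only [rootedSum]
  rw [Finset.sum_comm]
  refine Finset.sum_congr rfl fun a _ => ?_
  split_ifs with h
  · obtain ⟨z, ⟨hz, hzy⟩, huniq⟩ := h.existsUnique_pred
    rw [Finset.sum_eq_single z]
    · simp [hz, hzy]
    · intro u _ hu
      by_cases hu' : IsRootedAt a u
      · have : (a u).2 ≠ y := fun h' => hu (huniq u ⟨hu', h'⟩)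
        simp [this]
      · simp [hu']
    · simp
  · refine Finset.sum_eq_zero fun z _ => ?_
    by_cases hz : IsRootedAt a z
    · have : (a z).2 ≠ y := fun h' => h (h' ▸ hz.snd)
      simp [this]
    · simp [hz]

end Sum

end Arrows

end

/-! ### Arborescences and spanning trees -/

noncomputable section

namespace Graph

open Function Arrows
open scoped ENNReal

variable {α β : Type*} {G : Graph α β}

/-- The edges of the arrows at the vertices other than `r`. -/
def arrowEdges (a : V(G) → E(G) × V(G)) (r : V(G)) : Set β :=
  {f | ∃ v, v ≠ r ∧ ((a v).1 : β) = f}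

/-- The arrows at the vertices other than `r` run along edges of `G` and lead to `r`. -/
structure IsArborescence (a : V(G) → E(G) × V(G)) (r : V(G)) : Prop where
  isLink : ∀ v, v ≠ r → G.IsLink (a v).1 v (a v).2
  isRootedAt : IsRootedAt a r

/-- Two distinct vertices with the same edge would point at each other, so each would have smaller
rank than the other. -/
lemma IsArborescence.injOn {a : V(G) → E(G) × V(G)} {r : V(G)} (h : IsArborescence a r) :
    Set.InjOn (fun v => (a v).1) {r}ᶜ := by
  obtain ⟨k, hk⟩ := h.isRootedAt.exists_rank
  intro u hu v hv huv
  simp only at huv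
  have h₁ := h.isLink u hu
  rw [huv] at h₁
  rcases h₁.eq_and_eq_or_eq_and_eq (h.isLink v hv) with ⟨h₂, -⟩ | ⟨h₂, h₃⟩
  · exact Subtype.ext h₂
  · have h₄ := hk u hu
    have h₅ := hk v hv
    rw [Subtype.ext h₃] at h₄
    rw [← Subtype.ext h₂] at h₅
    omega

lemma IsArborescence.connected_restrict {a : V(G) → E(G) × V(G)} {r : V(G)}
    (h : IsArborescence a r) : (G.restrict (arrowEdges a r)).Connected := by
  obtain ⟨k, hk⟩ := h.isRootedAt.exists_rank
  have key : ∀ v : V(G), Relation.ReflTransGen (G.restrict (arrowEdges a r)).Adj v r := by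
    intro v
    induction hm : k v using Nat.strong_induction_on generalizing v with
    | _ m ih =>
      by_cases hv : v = r
      · rw [hv]
      · refine Relation.ReflTransGen.head ⟨(a v).1, ?_⟩ (ih _ (hm ▸ hk v hv) _ rfl)
        rw [restrict_isLink]
        exact ⟨⟨v, hv, rfl⟩, h.isLink v hv⟩
  refine ⟨⟨r, r.2⟩, fun u hu v hv => (key ⟨u, hu⟩).trans ?_⟩
  exact Std.Symm.symm _ _ (key ⟨v, hv⟩)

lemma IsArborescence.acyclic_restrict {a : V(G) → E(G) × V(G)} {r : V(G)}
    (h : IsArborescence a r) : (G.restrict (arrowEdges a r)).Acyclic := by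
  obtain ⟨k, hk⟩ := h.isRootedAt.exists_rank
  rintro ⟨n, v, e, -, he, hl⟩
  simp only [restrict_isLink] at hl
  choose u hur hue using fun i => (hl i).1
  replace hl := fun i => (hl i).2
  have hu : ∀ i, (∃ j, v j = u i) ∧ ∃ m, v m = (a (u i)).2 := by
    intro i
    have h₁ := h.isLink (u i) (hur i)
    rw [hue i] at h₁
    rcases h₁.eq_and_eq_or_eq_and_eq (hl i) with ⟨h₂, h₃⟩ | ⟨h₂, h₃⟩
    · exact ⟨⟨i, h₂.symm⟩, i + 1, h₃.symm⟩
    · exact ⟨⟨i + 1, h₂.symm⟩, i, h₃.symm⟩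
  choose j hj using fun i => (hu i).1
  choose m hm using fun i => (hu i).2
  -- Distinct edges have distinct tails, so by counting every vertex of the cycle is the tail of one
  -- of its arrows. At a vertex of minimal rank the arrow leads to a smaller rank, still on the
  -- cycle.
  have hjinj : Injective j := by
    intro i i' hii
    have h₁ : u i = u i' := Subtype.ext (by rw [← hj i, ← hj i', hii])
    exact he (by rw [← hue i, ← hue i', h₁])
  have hvmem : ∀ i, v i ∈ V(G) := fun i => (hl i).left_mem
  obtain ⟨i₀, hi₀⟩ := Finite.exists_min fun i => k ⟨v i, hvmem i⟩
  obtain ⟨i, rfl⟩ := Finite.surjective_of_injective hjinj i₀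
  have h₁ := hk (u i) (hur i)
  have h₂ := hi₀ (m i)
  rw [show (⟨v (j i), hvmem _⟩ : V(G)) = u i from Subtype.ext (hj i),
    show (⟨v (m i), hvmem _⟩ : V(G)) = (a (u i)).2 from Subtype.ext (hm i)] at h₂
  omega

lemma IsArborescence.isSpanningTree {a : V(G) → E(G) × V(G)} {r : V(G)}
    (h : IsArborescence a r) : G.IsSpanningTree (arrowEdges a r) := by
  refine ⟨?_, h.connected_restrict, h.acyclic_restrict⟩
  rintro _ ⟨v, -, rfl⟩
  exact (a v).1.2

open Classical in
lemma Connected.exists_rank {H : Graph α β} (h : H.Connected) {r : α} (hr : r ∈ V(H)) :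
    ∃ k : α → ℕ, ∀ v ∈ V(H), v ≠ r → ∃ z, H.Adj v z ∧ k z < k v := by
  -- `S n v`: some walk of `n` edges leads from `v` to `r`. The rank is the distance to `r`.
  let S : ℕ → α → Prop := fun n => Nat.rec (motive := fun _ => α → Prop) (fun v => v = r)
    (fun _ s v => ∃ z, H.Adj v z ∧ s z) n
  have hS : ∀ v ∈ V(H), ∃ n, S n v := by
    intro v hv
    induction h.2 v hv r hr using Relation.ReflTransGen.head_induction_on with
    | refl => exact ⟨0, rfl⟩
    | head h₁ _ ih =>
      obtain ⟨n, hn⟩ := ih h₁.right_mem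
      exact ⟨n + 1, _, h₁, hn⟩
  refine ⟨fun v => if hv : ∃ n, S n v then Nat.find hv else 0, fun v hv hvr => ?_⟩
  have h₁ := Nat.find_spec (hS v hv)
  rcases h₂ : Nat.find (hS v hv) with _ | n
  · rw [h₂] at h₁
    exact absurd h₁ hvr
  · rw [h₂] at h₁
    obtain ⟨z, hz, hzn⟩ := h₁
    refine ⟨z, hz, ?_⟩
    simp only [dif_pos (hS v hv), dif_pos (⟨n, hzn⟩ : ∃ n, S n z), h₂]
    exact Nat.lt_succ_of_le (Nat.find_min' _ hzn)

open Classical in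
lemma exists_isArborescence [Nonempty E(G)] {t : Set β} (ht : (G.restrict t).Connected)
    (r : V(G)) : ∃ a : V(G) → E(G) × V(G), IsArborescence a r ∧ arrowEdges a r ⊆ t := by
  obtain ⟨k, hk⟩ := ht.exists_rank r.2
  have key : ∀ v : V(G), ∃ s : E(G) × V(G), v ≠ r →
      G.IsLink s.1 v s.2 ∧ (s.1 : β) ∈ t ∧ k s.2 < k v := by
    intro v
    by_cases hv : v = r
    -- The root also needs an arrow, although an irrelevant one; hence `Nonempty E(G)`.
    · exact ⟨(Classical.arbitrary _, v), fun h => absurd hv h⟩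
    · obtain ⟨z, ⟨e, he⟩, hz⟩ := hk v v.2 (fun h => hv (Subtype.ext h))
      rw [restrict_isLink] at he
      exact ⟨(⟨e, he.2.edge_mem⟩, ⟨z, he.2.right_mem⟩), fun _ => ⟨he.2, he.1, hz⟩⟩
  choose a ha using key
  refine ⟨a, ⟨fun v hv => (ha v hv).1,
    isRootedAt_of_rank (fun v => k v) fun v hv => (ha v hv).2.2⟩, ?_⟩
  rintro _ ⟨v, hv, rfl⟩
  exact (ha v hv).2.1

open Classical in
/-- An arborescence contained in an acyclic set of edges exhausts it. -/
lemma IsArborescence.arrowEdges_eq {a : V(G) → E(G) × V(G)} {r : V(G)} (h : IsArborescence a r)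
    {t : Set β} (htE : t ⊆ E(G)) (ht : (G.restrict t).Acyclic) (hat : arrowEdges a r ⊆ t) :
    arrowEdges a r = t := by
  refine hat.antisymm fun f hf => by_contra fun hfa => ht ?_
  have : Nonempty E(G) := ⟨⟨f, htE hf⟩⟩
  obtain ⟨u, v, hfuv⟩ := exists_isLink_of_mem_edgeSet (htE hf)
  lift u to V(G) using hfuv.left_mem
  lift v to V(G) using hfuv.right_mem
  -- Reroot the arborescence at `v`, an end of the missing edge `f`. The arrows of `b` from `u` to
  -- `v`, closed up by `f`, form a cycle in `t`; for `u = v` it is the self-edge `f` alone.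
  obtain ⟨b, hb, hba⟩ := exists_isArborescence h.connected_restrict v
  obtain ⟨k, hk⟩ := hb.isRootedAt.exists_rank
  set p : V(G) → V(G) := fun z => (b z).2 with hp
  have hn := Nat.find_spec (hb.isRootedAt u)
  have hmin := fun m => Nat.find_min (hb.isRootedAt u) (m := m)
  set n := Nat.find (hb.isRootedAt u) with hndef
  have hanti : ∀ i j, i < j → j ≤ n → k (p^[j] u) < k (p^[i] u) := by
    intro i j hij
    induction j, hij using Nat.le_induction with
    | base =>
      intro hj
      rw [iterate_succ_apply']
      exact hk _ (hmin i hj)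
    | succ j hij ih =>
      intro hj
      refine lt_trans ?_ (ih (by omega))
      rw [iterate_succ_apply']
      exact hk _ (hmin j hj)
  have hinj : ∀ i j, i ≤ n → j ≤ n → p^[i] u = p^[j] u → i = j := by
    intro i j hi hj hij
    rcases lt_trichotomy i j with h' | h' | h'
    · exact absurd (hanti i j h' hj) (by rw [hij]; exact lt_irrefl _)
    · exact h'
    · exact absurd (hanti j i h' hi) (by rw [hij]; exact lt_irrefl _)
  have hmem : ∀ i, i < n → ((b (p^[i] u)).1 : β) ∈ arrowEdges a r := fun i hi =>
    hba ⟨_, hmin i hi, rfl⟩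
  refine ⟨n, fun i => p^[i] u, fun i => if (i : ℕ) < n then ((b (p^[i] u)).1 : β) else f,
    ?_, ?_, ?_⟩
  · intro i j hij
    exact Fin.ext (hinj _ _ (Nat.lt_succ_iff.1 i.2) (Nat.lt_succ_iff.1 j.2) (Subtype.ext hij))
  · intro i j hij
    simp only at hij
    have hi := i.2
    have hj := j.2
    split_ifs at hij with h₁ h₂ h₂
    · exact Fin.ext (hinj _ _ h₁.le h₂.le
        (hb.injOn (hmin _ h₁) (hmin _ h₂) (Subtype.ext hij)))
    · exact absurd (hij ▸ hmem _ h₁) hfa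
    · exact absurd (hij ▸ hmem _ h₂) hfa
    · exact Fin.ext (by omega)
  · intro i
    simp only [restrict_isLink]
    by_cases h₁ : (i : ℕ) < n
    · have h₂ : ((i + 1 : Fin (n + 1)) : ℕ) = i + 1 := by
        rw [Fin.val_add_one_of_lt (Fin.lt_def.2 h₁)]
      rw [if_pos h₁, h₂, iterate_succ_apply']
      exact ⟨hat (hmem _ h₁), hb.isLink _ (hmin _ h₁)⟩
    · have h₂ : i = Fin.last n := Fin.ext (by have := i.2; simp; omega)
      subst h₂
      rw [if_neg h₁, Fin.last_add_one]
      refine ⟨hf, ?_⟩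
      have : p^[((Fin.last n : Fin (n + 1)) : ℕ)] u = v := hn
      rw [this]
      exact hfuv.symm

/-- An arborescence is determined by its root and its set of edges. -/
lemma IsArborescence.eq_of_arrowEdges_eq {a b : V(G) → E(G) × V(G)} {r : V(G)}
    (ha : IsArborescence a r) (hb : IsArborescence b r) (hab : arrowEdges a r = arrowEdges b r)
    (v : V(G)) (hv : v ≠ r) : a v = b v := by
  obtain ⟨k, hk⟩ := hb.isRootedAt.exists_rank
  have key : ((a v).1 : β) = (b v).1 := by
    induction hm : k v using Nat.strong_induction_on generalizing v with
    | _ m ih =>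
      have h₁ : ((b v).1 : β) ∈ arrowEdges a r := hab ▸ ⟨v, hv, rfl⟩
      obtain ⟨u, hu, huv⟩ := h₁
      have h₂ := ha.isLink u hu
      -- The edge of `b` at `v` is the edge of `a` at some `u`. If `u ≠ v`, then `u` is the head of
      -- the arrow of `b` at `v`; by induction `b` uses this edge at `u` as well, against `injOn`.
      rw [huv] at h₂
      rcases h₂.left_eq_or_eq (hb.isLink v hv) with h₃ | h₃
      · rw [← Subtype.ext h₃, huv, Subtype.ext h₃]
      · have h₄ := hk v hv
        rw [← Subtype.ext h₃] at h₄
        have h₅ := ih _ (hm ▸ h₄) u hu rfl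
        have h₆ : u = v := hb.injOn hu hv (Subtype.ext (h₅.symm.trans huv))
        rw [h₆] at h₄
        exact absurd h₄ (lt_irrefl _)
  have h₁ := ha.isLink v hv
  rw [key] at h₁
  exact Prod.ext (Subtype.ext key) (Subtype.ext (h₁.right_unique (hb.isLink v hv)))

end Graph

end

/-! ### Weights of arborescences and of spanning trees -/

noncomputable section

namespace Graph

open Function Arrows
open scoped ENNReal

variable {α β : Type*} {G : Graph α β}

open Classical in
/-- The weight of an arrow `s` at `v`: the weight of its edge if it connects `v` to the head of
the arrow, and `0` otherwise. -/
def arrowWeight (G : Graph α β) (w : β → ℝ) (v : V(G)) (s : E(G) × V(G)) : ℝ≥0∞ :=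
  if G.IsLink s.1 v s.2 then ENNReal.ofReal (w s.1) else 0

open Classical in
lemma arrowWeight_comm (w : β → ℝ) (u v : V(G)) (e : E(G)) :
    G.arrowWeight w u (e, v) = G.arrowWeight w v (e, u) := by
  rw [arrowWeight, arrowWeight]
  exact if_congr G.isLink_comm rfl rfl

lemma finite_setOf_isSpanningTree (hE : E(G).Finite) : {u | G.IsSpanningTree u}.Finite :=
  hE.finite_subsets.subset fun _ hu => hu.1

section Finite

variable [Fintype V(G)] {w : β → ℝ}

lemma isArborescence_of_prod_ne_zero {a : V(G) → E(G) × V(G)} {r : V(G)} (h : IsRootedAt a r)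
    (ha : ∏ v, G.arrowWeight w v (a v) ≠ 0) : IsArborescence a r := by
  refine ⟨fun v _ => ?_, h⟩
  by_contra hv
  exact ha (Finset.prod_eq_zero (Finset.mem_univ v) (if_neg hv))

open Classical in
lemma IsArborescence.prod_arrowWeight (hw : ∀ e ∈ E(G), 0 < w e)
    {a : V(G) → E(G) × V(G)} {r : V(G)} (h : IsArborescence a r) :
    ∏ v ∈ Finset.univ.erase r, G.arrowWeight w v (a v) =
      ENNReal.ofReal (treeWeight w (arrowEdges a r)) := by
  have h₁ : arrowEdges a r = (fun v => ((a v).1 : β)) '' ((Finset.univ.erase r : Finset V(G))) := by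
    ext f
    simp [arrowEdges]
  have h₂ : Set.InjOn (fun v => ((a v).1 : β)) ((Finset.univ.erase r : Finset V(G)) : Set V(G)) :=
    fun u hu v hv huv => h.injOn (by simpa using hu) (by simpa using hv) (Subtype.ext huv)
  rw [treeWeight, h₁, finprod_mem_image h₂, finprod_mem_coe_finset,
    ENNReal.ofReal_prod_of_nonneg fun v _ => (hw _ (a v).1.2).le]
  exact Finset.prod_congr rfl fun v hv => if_pos (h.isLink v (Finset.ne_of_mem_erase hv))

variable [Fintype E(G)]

open Classical in
-- The tree determines every arrow except the one at the root, whose free choice contributes the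
-- first factor.
lemma rootedSum_arrowEdges_eq [Nonempty E(G)] (hw : ∀ e ∈ E(G), 0 < w e) {t : Set β}
    (ht : G.IsSpanningTree t) (r : V(G)) :
    rootedSum (G.arrowWeight w) r (fun a => if arrowEdges a r = t then 1 else 0) =
      (∑ s, G.arrowWeight w r s) * ENNReal.ofReal (treeWeight w t) := by
  obtain ⟨b, hb, hbt⟩ := exists_isArborescence ht.2.1 r
  replace hbt := hb.arrowEdges_eq ht.1 ht.2.2 hbt
  have hoff : ∀ s v, v ≠ r → update b r s v = b v := fun s v hv => update_of_ne hv s b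
  have hedges : ∀ s, arrowEdges (update b r s) r = t := by
    intro s
    rw [← hbt]
    ext f
    exact exists_congr fun v => and_congr_right fun hv => by rw [hoff s v hv]
  rw [Finset.sum_mul, rootedSum]
  symm
  refine Finset.sum_of_injOn (update b r) (update_injective b r).injOn (by simp) ?_ ?_
  · intro a _ ha
    split_ifs with h₁ h₂
    · rw [mul_one]
      by_contra h₃
      have h₄ := (isArborescence_of_prod_ne_zero h₁ h₃).eq_of_arrowEdges_eq hb (h₂.trans hbt.symm)
      refine ha ⟨a r, by simp, ?_⟩
      funext v
      by_cases hv : v = r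
      · rw [hv, update_self]
      · rw [hoff _ v hv, h₄ v hv]
    · simp
    · rfl
  · intro s _
    rw [if_pos (isRootedAt_update_iff.2 hb.isRootedAt), if_pos (hedges s), mul_one,
      ← Finset.mul_prod_erase _ _ (Finset.mem_univ r), update_self, ← hbt,
      ← hb.prod_arrowWeight hw]
    congr 1
    exact Finset.prod_congr rfl fun v hv => by rw [hoff s v (Finset.ne_of_mem_erase hv)]

open Classical in
lemma rootedSum_one [Nonempty E(G)] (hw : ∀ e ∈ E(G), 0 < w e) (hE : E(G).Finite) (r : V(G)) :
    rootedSum (G.arrowWeight w) r (fun _ => 1) = (∑ s, G.arrowWeight w r s) *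
      ∑ t ∈ (finite_setOf_isSpanningTree hE).toFinset, ENNReal.ofReal (treeWeight w t) := by
  have h₁ : ∀ t ∈ (finite_setOf_isSpanningTree hE).toFinset,
      (∑ s, G.arrowWeight w r s) * ENNReal.ofReal (treeWeight w t) =
      rootedSum (G.arrowWeight w) r (fun a => if arrowEdges a r = t then 1 else 0) :=
    fun t ht => (rootedSum_arrowEdges_eq hw (by simpa using ht) r).symm
  rw [Finset.mul_sum, Finset.sum_congr rfl h₁]
  simp only [rootedSum]
  rw [Finset.sum_comm]
  refine Finset.sum_congr rfl fun a _ => ?_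
  split_ifs with h₂
  · rw [← Finset.mul_sum, Finset.sum_ite_eq]
    by_cases h₃ : ∏ v, G.arrowWeight w v (a v) = 0
    · rw [h₃, zero_mul, zero_mul]
    · rw [if_pos]
      simpa using (isArborescence_of_prod_ne_zero h₂ h₃).isSpanningTree
  · simp

/-- An edge incident to `v` has exactly one other end, so it carries exactly one arrow at `v`, even
if it is a self-edge. -/
lemma sum_arrowWeight (hw : ∀ e ∈ E(G), 0 < w e) (v : V(G)) :
    ∑ s, G.arrowWeight w v s = ENNReal.ofReal (G.weightedDegree w v) := by
  classical
  have h₁ : G.incidenceSet v =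
      (fun e : E(G) => (e : β)) '' (Finset.univ.filter fun e : E(G) => G.Inc e v) := by
    ext f
    simp only [mem_incidenceSet, Finset.coe_filter, Finset.mem_univ, true_and, Set.mem_image,
      Set.mem_ofPred_eq, Subtype.exists, exists_and_left, exists_prop, exists_eq_right_right]
    exact ⟨fun h => ⟨h, h.edge_mem⟩, fun h => h.1⟩
  rw [weightedDegree, h₁, finsum_mem_image Subtype.val_injective.injOn, finsum_mem_coe_finset,
    ENNReal.ofReal_sum_of_nonneg fun (e : E(G)) _ => (hw e e.2).le, Finset.sum_filter,
    Fintype.sum_prod_type]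
  refine Finset.sum_congr rfl fun e _ => ?_
  simp only [arrowWeight]
  split_ifs with h
  · obtain ⟨u, hu⟩ := h
    rw [Finset.sum_eq_single ⟨u, hu.right_mem⟩]
    · rw [if_pos hu]
    · intro z _ hz
      rw [if_neg]
      exact fun h' => hz (Subtype.ext (h'.right_unique hu))
    · simp
  · exact Finset.sum_eq_zero fun u _ => if_neg fun h' => h ⟨u, h'⟩

lemma Connected.sum_arrowWeight_ne_zero [Nonempty E(G)] (hG : G.Connected)
    (hw : ∀ e ∈ E(G), 0 < w e) (v : V(G)) : ∑ s, G.arrowWeight w v s ≠ 0 := by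
  have h₁ : ∃ e u, G.IsLink e v u := by
    obtain ⟨e, he⟩ := Classical.arbitrary E(G)
    obtain ⟨a, b, hab⟩ := exists_isLink_of_mem_edgeSet he
    rcases (hG.2 v v.2 a hab.left_mem).cases_head with h | ⟨u, ⟨f, hf⟩, -⟩
    · exact ⟨e, b, h ▸ hab⟩
    · exact ⟨f, u, hf⟩
  obtain ⟨e, u, h⟩ := h₁
  intro h₂
  have h₃ := (Finset.sum_eq_zero_iff.1 h₂)
    ((⟨e, h.edge_mem⟩, ⟨u, h.right_mem⟩) : E(G) × V(G)) (Finset.mem_univ _)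
  rw [arrowWeight, if_pos h, ENNReal.ofReal_eq_zero] at h₃
  exact absurd (hw e h.edge_mem) (not_lt.2 h₃)

lemma sum_arrowWeight_ne_top (hw : ∀ e ∈ E(G), 0 < w e) (v : V(G)) :
    ∑ s, G.arrowWeight w v s ≠ ⊤ := by
  rw [sum_arrowWeight hw]
  exact ENNReal.ofReal_ne_top

lemma Connected.ofReal_stepProb [Nonempty E(G)] (hG : G.Connected) (hw : ∀ e ∈ E(G), 0 < w e)
    (v u : V(G)) (e : E(G)) :
    ENNReal.ofReal (G.stepProb w v e u) = G.arrowWeight w v (e, u) / ∑ s, G.arrowWeight w v s := by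
  have h := hG.sum_arrowWeight_ne_zero hw v
  rw [sum_arrowWeight hw] at h ⊢
  rw [stepProb, arrowWeight]
  split_ifs
  · exact ENNReal.ofReal_div_of_pos (by simpa using h)
  · simp

end Finite

end Graph

end

/-! ### The Markov property and almost sure covering -/

noncomputable section

namespace Graph

open Function Arrows
open scoped ENNReal

section History

variable {V E Ω γ : Type*}

/-- `f` depends only on the positions up to time `n` and the edges travelled up to then. -/
def DependsOnHistory (X : ℕ → Ω → V) (Y : ℕ → Ω → E) (n : ℕ) (f : Ω → γ) : Prop :=
  ∀ ω₁ ω₂, (∀ i ≤ n, X i ω₁ = X i ω₂) → (∀ i < n, Y i ω₁ = Y i ω₂) → f ω₁ = f ω₂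

/-- The positions up to time `n` and the edges travelled up to then. -/
def history (X : ℕ → Ω → V) (Y : ℕ → Ω → E) (n : ℕ) (ω : Ω) : (Fin (n + 1) → V) × (Fin n → E) :=
  (fun i => X i ω, fun i => Y i ω)

lemma history_eq_iff {X : ℕ → Ω → V} {Y : ℕ → Ω → E} {n : ℕ} {ω ω' : Ω} :
    history X Y n ω = history X Y n ω' ↔
      (∀ i ≤ n, X i ω = X i ω') ∧ ∀ i < n, Y i ω = Y i ω' := by
  simp only [history, Prod.mk.injEq, funext_iff, Fin.forall_iff, Nat.lt_succ_iff]

lemma DependsOnHistory.exists_eq_comp {X : ℕ → Ω → V} {Y : ℕ → Ω → E} {n : ℕ} {f : Ω → ℝ≥0∞}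
    (hf : DependsOnHistory X Y n f) : ∃ g, f = g ∘ history X Y n := by
  refine ⟨extend (history X Y n) f 0, funext fun ω => ?_⟩
  have h : FactorsThrough f (history X Y n) := fun ω ω' hω =>
    hf ω ω' (history_eq_iff.1 hω).1 (history_eq_iff.1 hω).2
  exact (h.extend_apply 0 ω).symm

end History

namespace IsWeightedRandomWalk

variable {α β : Type*} {G : Graph α β} {w : β → ℝ} {x : V(G)} {Ω : Type*} [MeasurableSpace Ω]
  {P : Measure Ω} {X : ℕ → Ω → V(G)} {Y : ℕ → Ω → E(G)}

/-- The marginals at times `n` and `n + 1` differ by a single factor. Taking the history from a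
sample point `ω₀` makes it an attained one. -/
lemma measure_step (h : G.IsWeightedRandomWalk w x P X Y) (n : ℕ) (ω₀ : Ω) (e : E(G)) (z : V(G)) :
    P ({ω | history X Y n ω = history X Y n ω₀} ∩ {ω | Y n ω = e ∧ X (n + 1) ω = z}) =
      P {ω | history X Y n ω = history X Y n ω₀} *
        ENNReal.ofReal (G.stepProb w (X n ω₀) e z) := by
  classical
  have h₁ := h.marginal n (fun i => X i ω₀) (fun i => Y i ω₀)
  have h₂ := h.marginal (n + 1) (update (fun i => X i ω₀) (n + 1) z)
    (update (fun i => Y i ω₀) n e)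
  have hX : ∀ i ≤ n, update (fun i => X i ω₀) (n + 1) z i = X i ω₀ := fun i hi =>
    update_of_ne (by omega) _ _
  have hY : ∀ i < n, update (fun i => Y i ω₀) n e i = Y i ω₀ := fun i hi =>
    update_of_ne (by omega) _ _
  simp only [history_eq_iff]
  rw [h₁]
  convert h₂ using 1
  · congr 1
    ext ω
    constructor
    · rintro ⟨⟨h₃, h₄⟩, h₅, h₆⟩
      refine ⟨fun i hi => ?_, fun i hi => ?_⟩
      · rcases Nat.le_succ_iff.1 hi with hi | rfl
        · rw [hX i hi, h₃ i hi]
        · simpa using h₆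
      · rcases Nat.lt_succ_iff_lt_or_eq.1 hi with hi | rfl
        · rw [hY i hi, h₄ i hi]
        · simpa using h₅
    · rintro ⟨h₃, h₄⟩
      refine ⟨⟨fun i hi => ?_, fun i hi => ?_⟩, ?_, ?_⟩
      · rw [← hX i hi, h₃ i (by omega)]
      · rw [← hY i hi, h₄ i (by omega)]
      · simpa using h₄ n (by omega)
      · simpa using h₃ (n + 1) le_rfl
  · rw [Finset.prod_range_succ, hX 0 (Nat.zero_le _), hX n le_rfl, update_self, update_self,
      ite_mul, zero_mul]
    congr 2
    refine Finset.prod_congr rfl fun i hi => ?_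
    rw [Finset.mem_range] at hi
    rw [hX i hi.le, hY i hi, hX (i + 1) hi]

lemma measurableSet_history (h : G.IsWeightedRandomWalk w x P X Y) (n : ℕ)
    (k : (Fin (n + 1) → V(G)) × (Fin n → E(G))) : MeasurableSet (history X Y n ⁻¹' {k}) := by
  have : history X Y n ⁻¹' {k} =
      (⋂ i : Fin (n + 1), {ω | X i ω = k.1 i}) ∩ ⋂ i : Fin n, {ω | Y i ω = k.2 i} := by
    ext ω
    simp [history, Prod.ext_iff, funext_iff]
  rw [this]
  exact (MeasurableSet.iInter fun i => h.measurableSet_position _ _).inter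
    (MeasurableSet.iInter fun i => h.measurableSet_edge _ _)

lemma ae_position_zero (h : G.IsWeightedRandomWalk w x P X Y) [IsProbabilityMeasure P] :
    ∀ᵐ ω ∂P, X 0 ω = x := by
  have hne : Nonempty Ω := nonempty_of_isProbabilityMeasure P
  have h₁ := h.marginal 0 (fun _ => x) (fun _ => Y 0 hne.some)
  simp only [Nat.le_zero, forall_eq, not_lt_zero, IsEmpty.forall_iff, implies_true, and_true,
    if_true, Finset.range_zero, Finset.prod_empty] at h₁
  exact (mem_ae_iff_prob_eq_one (h.measurableSet_position 0 x)).2 h₁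

section Finite

variable [Fintype V(G)] [Fintype E(G)]

lemma measurable_of_dependsOnHistory (h : G.IsWeightedRandomWalk w x P X Y) {n : ℕ}
    {f : Ω → ℝ≥0∞} (hf : DependsOnHistory X Y n f) : Measurable f := by
  let _ : MeasurableSpace ((Fin (n + 1) → V(G)) × (Fin n → E(G))) := ⊤
  obtain ⟨g, rfl⟩ := hf.exists_eq_comp
  exact measurable_from_top.comp (measurable_to_countable' (h.measurableSet_history n))

lemma measurableSet_of_dependsOnHistory (h : G.IsWeightedRandomWalk w x P X Y) {n : ℕ}
    {p : Ω → Prop} (hp : DependsOnHistory X Y n p) : MeasurableSet {ω | p ω} := by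
  classical
  have h₁ : Measurable fun ω => if p ω then (1 : ℝ≥0∞) else 0 :=
    h.measurable_of_dependsOnHistory fun ω ω' hX hY => by rw [hp ω ω' hX hY]
  convert h₁ (measurableSet_singleton 1) using 1
  ext ω
  by_cases h₂ : p ω <;> simp [h₂]

lemma setLIntegral_step (h : G.IsWeightedRandomWalk w x P X Y) {n : ℕ} {f : Ω → ℝ≥0∞}
    (hf : DependsOnHistory X Y n f) (e : E(G)) (z : V(G)) :
    ∫⁻ ω in {ω | Y n ω = e ∧ X (n + 1) ω = z}, f ω ∂P =
      ∫⁻ ω, f ω * ENNReal.ofReal (G.stepProb w (X n ω) e z) ∂P := by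
  classical
  -- There are finitely many histories, so both integrals become finite sums over them; unattained
  -- ones contribute `0`.
  let _ : MeasurableSpace ((Fin (n + 1) → V(G)) × (Fin n → E(G))) := ⊤
  obtain ⟨g, rfl⟩ := hf.exists_eq_comp
  have hH : Measurable (history X Y n) := measurable_to_countable' (h.measurableSet_history n)
  let g' : (Fin (n + 1) → V(G)) × (Fin n → E(G)) → ℝ≥0∞ := fun k =>
    g k * ENNReal.ofReal (G.stepProb w (k.1 (Fin.last n)) e z)
  have hg' : ∀ ω, (g ∘ history X Y n) ω * ENNReal.ofReal (G.stepProb w (X n ω) e z) =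
      g' (history X Y n ω) := fun ω => rfl
  simp only [hg']
  simp only [comp_apply]
  rw [← lintegral_map (f := g') measurable_from_top hH,
    ← lintegral_map (f := g) measurable_from_top hH, lintegral_fintype, lintegral_fintype]
  refine Finset.sum_congr rfl fun k _ => ?_
  rw [Measure.map_apply hH (measurableSet_singleton k),
    Measure.map_apply hH (measurableSet_singleton k),
    Measure.restrict_apply (hH (measurableSet_singleton k))]
  by_cases hk : ∃ ω₀, history X Y n ω₀ = k
  · obtain ⟨ω₀, rfl⟩ := hk
    have := h.measure_step n ω₀ e z
    change P (history X Y n ⁻¹' {history X Y n ω₀} ∩ _) =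
      P (history X Y n ⁻¹' {history X Y n ω₀}) * _ at this
    rw [this, mul_comm (P _), ← mul_assoc]
    rfl
  · have : history X Y n ⁻¹' {k} = ∅ := by
      ext ω
      simpa using fun h' => hk ⟨ω, h'⟩
    simp [this]

/-- The Markov property. -/
lemma lintegral_succ (h : G.IsWeightedRandomWalk w x P X Y) {n : ℕ}
    {F : E(G) → V(G) → Ω → ℝ≥0∞} (hF : ∀ e z, DependsOnHistory X Y n (F e z)) :
    ∫⁻ ω, F (Y n ω) (X (n + 1) ω) ω ∂P =
      ∫⁻ ω, ∑ z : V(G), ∑ e : E(G), ENNReal.ofReal (G.stepProb w (X n ω) e z) * F e z ω ∂P := by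
  classical
  have hS : ∀ e z, MeasurableSet {ω | Y n ω = e ∧ X (n + 1) ω = z} := fun e z =>
    (h.measurableSet_edge n e).inter (h.measurableSet_position (n + 1) z)
  have h₁ : ∀ ω, F (Y n ω) (X (n + 1) ω) ω =
      ∑ z, ∑ e, {ω | Y n ω = e ∧ X (n + 1) ω = z}.indicator (F e z) ω := by
    intro ω
    rw [Finset.sum_eq_single (X (n + 1) ω), Finset.sum_eq_single (Y n ω)]
    · simp
    · intro e _ he
      exact Set.indicator_of_notMem (fun h' => he h'.1.symm) _
    · simp
    · intro z _ hz
      exact Finset.sum_eq_zero fun e _ => Set.indicator_of_notMem (fun h' => hz h'.2.symm) _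
    · simp
  have hm : ∀ e z, Measurable (F e z) := fun e z => h.measurable_of_dependsOnHistory (hF e z)
  have hm' : ∀ e z, Measurable fun ω => F e z ω * ENNReal.ofReal (G.stepProb w (X n ω) e z) :=
    fun e z => h.measurable_of_dependsOnHistory fun ω ω' hX hY => by
      rw [hF e z ω ω' hX hY, hX n le_rfl]
  simp only [h₁, mul_comm (ENNReal.ofReal _)]
  rw [lintegral_finsetSum _ fun z _ => Finset.measurable_sum _ fun e _ =>
      (hm e z).indicator (hS e z),
    lintegral_finsetSum _ fun z _ => Finset.measurable_sum _ fun e _ => hm' e z]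
  refine Finset.sum_congr rfl fun z _ => ?_
  rw [lintegral_finsetSum _ fun e _ => (hm e z).indicator (hS e z),
    lintegral_finsetSum _ fun e _ => hm' e z]
  refine Finset.sum_congr rfl fun e _ => ?_
  rw [lintegral_indicator (hS e z), h.setLIntegral_step (hF e z)]

lemma ae_isLink (h : G.IsWeightedRandomWalk w x P X Y) :
    ∀ᵐ ω ∂P, ∀ n, G.IsLink (Y n ω) (X n ω) (X (n + 1) ω) := by
  classical
  rw [ae_all_iff]
  intro n
  let F : E(G) → V(G) → Ω → ℝ≥0∞ := fun e z ω => if G.IsLink e (X n ω) z then 0 else 1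
  have h₁ := h.lintegral_succ (n := n) (F := F)
    (fun e z ω ω' hX hY => by simp only [F, hX n le_rfl])
  have h₂ : ∀ ω, ∑ z : V(G), ∑ e : E(G), ENNReal.ofReal (G.stepProb w (X n ω) e z) * F e z ω = 0 := by
    intro ω
    refine Finset.sum_eq_zero fun z _ => Finset.sum_eq_zero fun e _ => ?_
    by_cases h₃ : G.IsLink e (X n ω) z <;> simp [F, stepProb, h₃]
  have hm : Measurable fun ω => F (Y n ω) (X (n + 1) ω) ω :=
    h.measurable_of_dependsOnHistory (n := n + 1) fun ω ω' hX hY => by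
      simp only [F, hX n (by omega), hX (n + 1) le_rfl, hY n (by omega)]
  simp only [h₂, lintegral_zero] at h₁
  filter_upwards [(lintegral_eq_zero_iff hm).1 h₁] with ω hω
  by_contra h₃
  simp [F, h₃] at hω

/-- The sum is the expected number of visits to `u` before `v` is reached. It is bounded by
induction along a path from `u` to `v`: each such visit is followed with a fixed positive
probability by a step to the next vertex `u'` of the path. -/
lemma tsum_measure_ne_top (h : G.IsWeightedRandomWalk w x P X Y) [IsProbabilityMeasure P]
    (hG : G.Connected) (hw : ∀ e ∈ E(G), 0 < w e) (v u : V(G)) :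
    ∑' n, P {ω | X n ω = u ∧ ∀ i ≤ n, X i ω ≠ v} ≠ ⊤ := by
  classical
  have hΩ : Nonempty Ω := nonempty_of_isProbabilityMeasure P
  have hne : Nonempty E(G) := ⟨Y 0 hΩ.some⟩
  obtain ⟨u, hu⟩ := u
  induction hG.2 u hu v v.2 using Relation.ReflTransGen.head_induction_on with
  | refl =>
    have : ∀ n, {ω | X n ω = v ∧ ∀ i ≤ n, X i ω ≠ v} = ∅ := by
      intro n
      ext ω
      simpa using fun h₁ => ⟨n, le_rfl, h₁⟩
    simp [this]
  | @head u u' huu' _ ih =>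
    obtain ⟨e, he⟩ := huu'
    have hu' := he.right_mem
    specialize ih hu'
    set s := ENNReal.ofReal (G.stepProb w u e u') with hs
    have hs₀ : s ≠ 0 := by
      have h₁ := hG.ofReal_stepProb hw ⟨u, hu⟩ ⟨u', hu'⟩ ⟨e, he.edge_mem⟩
      rw [← hs] at h₁
      rw [h₁]
      refine ENNReal.div_ne_zero.2 ⟨?_, sum_arrowWeight_ne_top hw _⟩
      rw [arrowWeight, if_pos he]
      simpa using hw e he.edge_mem
    have h₁ : ∀ n, P {ω | X n ω = ⟨u, hu⟩ ∧ ∀ i ≤ n, X i ω ≠ v} * s ≤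
        P {ω | X (n + 1) ω = ⟨u', hu'⟩ ∧ ∀ i ≤ n, X i ω ≠ v} := by
      intro n
      have hD : DependsOnHistory X Y n fun ω => X n ω = ⟨u, hu⟩ ∧ ∀ i ≤ n, X i ω ≠ v := by
        intro ω ω' hX _
        simp only [hX n le_rfl]
        exact propext (and_congr_right fun _ =>
          forall_congr' fun i => forall_congr' fun hi => by rw [hX i hi])
      have hS := h.measurableSet_of_dependsOnHistory hD
      have h₂ := h.setLIntegral_step (n := n)
        (f := {ω | X n ω = ⟨u, hu⟩ ∧ ∀ i ≤ n, X i ω ≠ v}.indicator 1)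
        (fun ω ω' hX hY => by
          have := hD ω ω' hX hY
          simp only [Set.indicator_apply, Set.mem_ofPred_eq, this, Pi.one_apply])
        ⟨e, he.edge_mem⟩ ⟨u', hu'⟩
      rw [lintegral_indicator_one hS, Measure.restrict_apply hS] at h₂
      have h₃ : ∀ ω, {ω | X n ω = ⟨u, hu⟩ ∧ ∀ i ≤ n, X i ω ≠ v}.indicator 1 ω *
          ENNReal.ofReal (G.stepProb w (X n ω) e u') =
          {ω | X n ω = ⟨u, hu⟩ ∧ ∀ i ≤ n, X i ω ≠ v}.indicator (fun _ => s) ω := by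
        intro ω
        by_cases hω : ω ∈ {ω | X n ω = ⟨u, hu⟩ ∧ ∀ i ≤ n, X i ω ≠ v}
        · rw [Set.indicator_of_mem hω, Set.indicator_of_mem hω, hω.1, Pi.one_apply, one_mul]
        · rw [Set.indicator_of_notMem hω, Set.indicator_of_notMem hω, zero_mul]
      simp only [h₃] at h₂
      rw [lintegral_indicator_const hS, mul_comm] at h₂
      rw [← h₂]
      exact measure_mono fun ω hω => ⟨hω.2.2, hω.1.2⟩
    have h₂ : ∑' n, P {ω | X (n + 1) ω = ⟨u', hu'⟩ ∧ ∀ i ≤ n, X i ω ≠ v} ≠ ⊤ := by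
      -- If `u' = v`, the events say that `v` is first reached at time `n + 1`, so they are
      -- disjoint. Otherwise `v` is still avoided at time `n + 1`, and the induction hypothesis
      -- applies.
      by_cases hv : (⟨u', hu'⟩ : V(G)) = v
      · rw [hv]
        have hdisj : Pairwise (Disjoint on fun n =>
            {ω | X (n + 1) ω = v ∧ ∀ i ≤ n, X i ω ≠ v}) := by
          rw [pairwise_disjoint_on]
          intro m n hmn
          rw [Set.disjoint_left]
          exact fun ω h₂ h₃ => h₃.2 (m + 1) hmn h₂.1
        rw [← measure_iUnion hdisj fun n => h.measurableSet_of_dependsOnHistory (n := n + 1) ?_]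
        · exact measure_ne_top _ _
        · intro ω ω' hX _
          simp only [hX (n + 1) le_rfl]
          exact propext (and_congr_right fun _ =>
            forall_congr' fun i => forall_congr' fun hi => by rw [hX i (by omega)])
      · refine ne_top_of_le_ne_top ih (le_trans (ENNReal.tsum_le_tsum fun n => measure_mono ?_)
          (ENNReal.tsum_comp_le_tsum_of_injective (add_left_injective 1) _))
        rintro ω ⟨h₂, h₃⟩
        refine ⟨h₂, fun i hi => ?_⟩
        rcases Nat.le_succ_iff.1 hi with hi | rfl
        · exact h₃ i hi
        · rw [h₂]
          exact hv
    have h₃ := ne_top_of_le_ne_top h₂ (ENNReal.tsum_le_tsum h₁)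
    rw [ENNReal.tsum_mul_right] at h₃
    exact (ENNReal.lt_top_of_mul_ne_top_left h₃ hs₀).ne

lemma ae_exists_position_eq (h : G.IsWeightedRandomWalk w x P X Y) [IsProbabilityMeasure P]
    (hG : G.Connected) (hw : ∀ e ∈ E(G), 0 < w e) : ∀ᵐ ω ∂P, ∀ v, ∃ n, X n ω = v := by
  rw [ae_all_iff]
  intro v
  by_contra h₁
  rw [ae_iff] at h₁
  push Not at h₁
  -- Summed over `u`, the `n`-th terms are at least the probability of never visiting `v`; if that
  -- were positive, the series would diverge.
  refine ENNReal.sum_ne_top.2 (fun u (_ : u ∈ Finset.univ) => h.tsum_measure_ne_top hG hw v u) ?_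
  rw [← Summable.tsum_finsetSum fun _ _ => ENNReal.summable]
  refine top_unique (le_trans (ENNReal.tsum_const_eq_top_of_ne_zero (α := ℕ) h₁).ge ?_)
  refine ENNReal.tsum_le_tsum fun n => le_trans (measure_mono ?_) (measure_biUnion_finset_le _ _)
  intro ω hω
  simpa using fun i _ => hω i

end Finite

end IsWeightedRandomWalk

end Graph

end

/-! ### Prepending the walk, and the martingale -/

noncomputable section

namespace Graph

open Function Arrows
open scoped ENNReal

section PrependWalk

open scoped Classical

variable {V E : Type*}

/-- The arrows `a`, overwritten at every vertex that the walk `y 0, …, y n` enters with the arrow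
back along the edge by which it is first entered (not counting the start of the walk as an
entrance). -/
def prependWalk (y : ℕ → V) (f : ℕ → E) : ℕ → (V → E × V) → V → E × V
  | 0, a => a
  | n + 1, a => prependWalk y f n (update a (y (n + 1)) (f n, y n))

lemma prependWalk_of_forall_ne {y : ℕ → V} {f : ℕ → E} {v : V} {n : ℕ}
    (h : ∀ j < n, y (j + 1) ≠ v) (a : V → E × V) : prependWalk y f n a v = a v := by
  induction n generalizing a with
  | zero => rfl
  | succ n ih =>
    rw [prependWalk, ih fun j hj => h j (by omega), update_of_ne (h n (by omega)).symm]

/-- Later steps are the inner updates, so the earliest entrance has the last word. -/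
lemma prependWalk_of_first {y : ℕ → V} {f : ℕ → E} {n k : ℕ} (hk : k < n)
    (h : ∀ j < k, y (j + 1) ≠ y (k + 1)) (a : V → E × V) :
    prependWalk y f n a (y (k + 1)) = (f k, y k) := by
  induction n generalizing a with
  | zero => omega
  | succ n ih =>
    rcases Nat.lt_succ_iff_lt_or_eq.1 hk with hk | rfl
    · exact ih hk _
    · rw [prependWalk, prependWalk_of_forall_ne h, update_self]

lemma prependWalk_congr {y y' : ℕ → V} {f f' : ℕ → E} {n : ℕ} (hy : ∀ i ≤ n, y i = y' i)
    (hf : ∀ i < n, f i = f' i) : prependWalk y f n = prependWalk y' f' n := by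
  induction n with
  | zero => rfl
  | succ n ih =>
    funext a
    rw [prependWalk, prependWalk, ih (fun i hi => hy i (by omega)) (fun i hi => hf i (by omega)),
      hy n (by omega), hy (n + 1) le_rfl, hf n (by omega)]

lemma exists_first_entrance {y : ℕ → V} {n : ℕ} (h : ∀ v, ∃ i ≤ n, y i = v) {v : V}
    (hv : v ≠ y 0) : ∃ k < n, y (k + 1) = v ∧ ∀ j ≤ k, y j ≠ v := by
  have h₁ := Nat.find_spec (h v)
  rcases h₂ : Nat.find (h v) with _ | k
  · rw [h₂] at h₁
    exact absurd h₁.2.symm hv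
  · rw [h₂] at h₁
    refine ⟨k, h₁.1, h₁.2, fun j hj hjv => ?_⟩
    exact Nat.find_min (h v) (m := j) (by omega) ⟨by omega, hjv⟩

end PrependWalk

variable {α β : Type*} {G : Graph α β}

lemma arrowEdges_prependWalk {y : ℕ → V(G)} {f : ℕ → E(G)} {n : ℕ} (h : ∀ v, ∃ i ≤ n, y i = v)
    (a : V(G) → E(G) × V(G)) : arrowEdges (prependWalk y f n a) (y 0) =
      groundskeeperTree (fun n => (y n : α)) (fun n => (f n : β)) := by
  ext g
  constructor
  · rintro ⟨v, hv, rfl⟩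
    obtain ⟨k, hk, rfl, hjk⟩ := exists_first_entrance h hv
    rw [prependWalk_of_first hk fun j hj => hjk (j + 1) hj]
    exact ⟨_, ⟨k, rfl, fun j hj h' => hjk j hj (Subtype.ext h')⟩, rfl⟩
  · rintro ⟨_, ⟨k, rfl, hjk⟩, rfl⟩
    replace hjk : ∀ j ≤ k, y j ≠ y (k + 1) := fun j hj h' => hjk j hj (congrArg Subtype.val h')
    obtain ⟨i, hi, hik⟩ := h (y (k + 1))
    have hkn : k < n := by
      by_contra hkn
      exact hjk i (by omega) hik
    refine ⟨y (k + 1), (hjk 0 (Nat.zero_le _)).symm, ?_⟩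
    rw [prependWalk_of_first hkn fun j hj => hjk (j + 1) hj]

lemma isArborescence_prependWalk {y : ℕ → V(G)} {f : ℕ → E(G)} {n : ℕ}
    (h : ∀ v, ∃ i ≤ n, y i = v) (hl : ∀ k, G.IsLink (f k) (y k) (y (k + 1)))
    (a : V(G) → E(G) × V(G)) : IsArborescence (prependWalk y f n a) (y 0) := by
  classical
  have h' : ∀ v, ∃ i, y i = v := fun v => (h v).imp fun i hi => hi.2
  -- The rank is the time of the first visit: a vertex is first entered from one visited earlier.
  refine ⟨fun v hv => ?_, isRootedAt_of_rank (fun v => Nat.find (h' v)) fun v hv => ?_⟩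
  · obtain ⟨k, hk, rfl, hjk⟩ := exists_first_entrance h hv
    rw [prependWalk_of_first hk fun j hj => hjk (j + 1) hj]
    exact (hl k).symm
  · obtain ⟨k, hk, rfl, hjk⟩ := exists_first_entrance h hv
    rw [prependWalk_of_first hk fun j hj => hjk (j + 1) hj]
    exact lt_of_le_of_lt (Nat.find_min' (h' (y k)) rfl)
      ((Nat.lt_find_iff (h' (y (k + 1))) k).2 hjk)

lemma exists_forall_exists_le [Finite V(G)] {y : ℕ → V(G)} (h : ∀ v, ∃ i, y i = v) :
    ∃ n, ∀ v, ∃ i ≤ n, y i = v := by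
  have := Fintype.ofFinite V(G)
  choose i hi using h
  exact ⟨Finset.univ.sup i, fun v => ⟨i v, Finset.le_sup (Finset.mem_univ v), hi v⟩⟩

lemma treeWeight_pos {w : β → ℝ} (hE : E(G).Finite) (hw : ∀ e ∈ E(G), 0 < w e) {t : Set β}
    (ht : G.IsSpanningTree t) : 0 < treeWeight w t := by
  rw [treeWeight, finprod_mem_eq_finite_toFinset_prod _ (hE.subset ht.1)]
  exact Finset.prod_pos fun e he => hw e (ht.1 (by simpa using he))

/-- The weighted sum, over the arborescences rooted at the position at time `n`, of a function of
the arrows obtained by prepending the walk up to time `n`. -/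
def arrowMartingale [Fintype V(G)] [Fintype E(G)] {Ω : Type*} (w : β → ℝ)
    (X : ℕ → Ω → V(G)) (Y : ℕ → Ω → E(G))
    (φ : (V(G) → E(G) × V(G)) → ℝ≥0∞) (n : ℕ) (ω : Ω) : ℝ≥0∞ :=
  rootedSum (G.arrowWeight w) (X n ω)
    (fun a => φ (prependWalk (fun i => X i ω) (fun i => Y i ω) n a)) /
      ∑ s, G.arrowWeight w (X n ω) s

lemma dependsOnHistory_arrowMartingale [Fintype V(G)] [Fintype E(G)] {Ω : Type*} (w : β → ℝ)
    (X : ℕ → Ω → V(G)) (Y : ℕ → Ω → E(G)) (φ : (V(G) → E(G) × V(G)) → ℝ≥0∞) (n : ℕ) :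
    DependsOnHistory X Y n (arrowMartingale w X Y φ n) := by
  intro ω ω' hX hY
  rw [arrowMartingale, arrowMartingale, prependWalk_congr hX hY, hX n le_rfl]

namespace IsWeightedRandomWalk

variable {w : β → ℝ} {x : V(G)} {Ω : Type*} [MeasurableSpace Ω]
  {P : Measure Ω} {X : ℕ → Ω → V(G)} {Y : ℕ → Ω → E(G)} [Fintype V(G)] [Fintype E(G)]

lemma lintegral_arrowMartingale (h : G.IsWeightedRandomWalk w x P X Y) [Nonempty E(G)]
    (hG : G.Connected) (hw : ∀ e ∈ E(G), 0 < w e) (φ : (V(G) → E(G) × V(G)) → ℝ≥0∞) (n : ℕ) :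
    ∫⁻ ω, arrowMartingale w X Y φ n ω ∂P = ∫⁻ ω, arrowMartingale w X Y φ 0 ω ∂P := by
  classical
  induction n with
  | zero => rfl
  | succ n ih =>
    rw [← ih]
    let F : E(G) → V(G) → Ω → ℝ≥0∞ := fun e z ω =>
      rootedSum (G.arrowWeight w) z (fun a => φ (prependWalk (fun i => X i ω) (fun i => Y i ω) n
        (update a z (e, X n ω)))) / ∑ s, G.arrowWeight w z s
    have h₁ : ∀ ω, arrowMartingale w X Y φ (n + 1) ω = F (Y n ω) (X (n + 1) ω) ω := by
      intro ω
      simp only [arrowMartingale, F, prependWalk]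
      congr!
    simp only [h₁]
    rw [h.lintegral_succ fun e z ω ω' hX hY => by
      simp only [F, prependWalk_congr hX hY, hX n le_rfl]]
    refine lintegral_congr fun ω => ?_
    -- Given the history, the root moves from `y = X n` to `z` with probability `c y (e, z) / d(y)`.
    -- Symmetry of the weights makes this `c z (e, y) / d(y)`, and exchanging the two degrees leaves
    -- the invariant sum at `y`, divided by `d(y)`.
    rw [arrowMartingale, ← sum_rootedSum_update _ (hG.sum_arrowWeight_ne_zero hw)
      (sum_arrowWeight_ne_top hw), div_eq_mul_inv, Finset.sum_mul]
    refine Finset.sum_congr rfl fun z _ => ?_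
    rw [Finset.sum_mul]
    refine Finset.sum_congr rfl fun e _ => ?_
    rw [hG.ofReal_stepProb hw, arrowWeight_comm]
    simp only [F, div_eq_mul_inv]
    have : ∀ a b c d : ℝ≥0∞, a * b * (c * d) = a * d * c * b := fun a b c d => by ring
    rw [this]
    congr!

/-- Markov's inequality at a fixed time bounds the event that the walk has covered by then and
produced `t`. These events increase to almost all of `T = t`, so no limit of the martingale is
needed. -/
lemma sum_mul_measure_le (h : G.IsWeightedRandomWalk w x P X Y) [IsProbabilityMeasure P]
    (hE : E(G).Finite) (hG : G.Connected) (hw : ∀ e ∈ E(G), 0 < w e) {t : Set β}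
    (ht : G.IsSpanningTree t) :
    (∑ u ∈ (finite_setOf_isSpanningTree hE).toFinset, ENNReal.ofReal (treeWeight w u)) *
      P {ω | groundskeeperTree (fun n => (X n ω : α)) (fun n => (Y n ω : β)) = t} ≤
      ENNReal.ofReal (treeWeight w t) := by
  classical
  have hΩ : Nonempty Ω := nonempty_of_isProbabilityMeasure P
  have hne : Nonempty E(G) := ⟨Y 0 hΩ.some⟩
  set Z := ∑ u ∈ (finite_setOf_isSpanningTree hE).toFinset, ENNReal.ofReal (treeWeight w u)
  let φ : (V(G) → E(G) × V(G)) → ℝ≥0∞ := fun a => if arrowEdges a x = t then 1 else 0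
  let C : ℕ → Set Ω := fun n => {ω | X 0 ω = x ∧ (∀ v, ∃ i ≤ n, X i ω = v) ∧
    groundskeeperTree (fun n => (X n ω : α)) (fun n => (Y n ω : β)) = t}
  have hC : Monotone C := fun m n hmn ω hω =>
    ⟨hω.1, fun v => (hω.2.1 v).imp fun i hi => ⟨hi.1.trans hmn, hi.2⟩, hω.2.2⟩
  have h₁ : P {ω | groundskeeperTree (fun n => (X n ω : α)) (fun n => (Y n ω : β)) = t} ≤
      P (⋃ n, C n) := by
    refine measure_mono_ae ?_
    filter_upwards [h.ae_position_zero, h.ae_exists_position_eq hG hw] with ω h₀ hcov hω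
    obtain ⟨n, hn⟩ := exists_forall_exists_le hcov
    exact Set.mem_iUnion.2 ⟨n, h₀, hn, hω⟩
  refine le_trans (mul_le_mul_right h₁ _) ?_
  rw [hC.measure_iUnion, ENNReal.mul_iSup]
  refine iSup_le fun n => ?_
  -- After covering, the prepended arrows have edge set `T = t` whatever `a` was, so `φ` is
  -- constantly `1` and the whole sum `Z` remains.
  have h₂ : C n ⊆ {ω | Z ≤ arrowMartingale w X Y φ n ω} := by
    rintro ω ⟨h₀, hcov, hω⟩
    have : ∀ a, φ (prependWalk (fun i => X i ω) (fun i => Y i ω) n a) = 1 := by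
      intro a
      have := arrowEdges_prependWalk (f := fun i => Y i ω) hcov a
      rw [hω, h₀] at this
      exact if_pos this
    change Z ≤ arrowMartingale w X Y φ n ω
    simp only [arrowMartingale, this]
    rw [rootedSum_one hw hE, mul_comm, ENNReal.mul_div_cancel_right
      (hG.sum_arrowWeight_ne_zero hw _) (sum_arrowWeight_ne_top hw _)]
  calc Z * P (C n) ≤ Z * P {ω | Z ≤ arrowMartingale w X Y φ n ω} :=
        mul_le_mul_right (measure_mono h₂) _
    _ ≤ ∫⁻ ω, arrowMartingale w X Y φ n ω ∂P := mul_meas_ge_le_lintegral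
        (h.measurable_of_dependsOnHistory (dependsOnHistory_arrowMartingale w X Y φ n)) _
    _ = ∫⁻ ω, arrowMartingale w X Y φ 0 ω ∂P := h.lintegral_arrowMartingale hG hw φ n
    _ = ∫⁻ _, ENNReal.ofReal (treeWeight w t) ∂P := by
        refine lintegral_congr_ae ?_
        filter_upwards [h.ae_position_zero] with ω hω
        simp only [arrowMartingale, hω, prependWalk, φ]
        rw [rootedSum_arrowEdges_eq hw ht, mul_comm, ENNReal.mul_div_cancel_right
          (hG.sum_arrowWeight_ne_zero hw _) (sum_arrowWeight_ne_top hw _)]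
    _ = ENNReal.ofReal (treeWeight w t) := by simp

lemma measurableSet_groundskeeperTree_eq (h : G.IsWeightedRandomWalk w x P X Y) {t : Set β}
    (ht : t ⊆ E(G)) :
    MeasurableSet {ω | groundskeeperTree (fun n => (X n ω : α)) (fun n => (Y n ω : β)) = t} := by
  have h₁ : ∀ e : E(G), MeasurableSet {ω | ∃ k, Y k ω = e ∧ ∀ j ≤ k, X j ω ≠ X (k + 1) ω} := by
    intro e
    rw [Set.ofPred_exists]
    refine MeasurableSet.iUnion fun k => h.measurableSet_of_dependsOnHistory (n := k + 1) ?_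
    intro ω ω' hX hY
    simp only [hY k (by omega), hX (k + 1) le_rfl]
    exact propext (and_congr_right fun _ =>
      forall_congr' fun i => forall_congr' fun hi => by rw [hX i (by omega)])
  have h₂ : {ω | groundskeeperTree (fun n => (X n ω : α)) (fun n => (Y n ω : β)) = t} =
      ⋂ e : E(G), {ω | (∃ k, Y k ω = e ∧ ∀ j ≤ k, X j ω ≠ X (k + 1) ω) ↔ (e : β) ∈ t} := by
    have h₃ : ∀ ω (e : E(G)), (e : β) ∈ groundskeeperTree (fun n => (X n ω : α))
        (fun n => (Y n ω : β)) ↔ ∃ k, Y k ω = e ∧ ∀ j ≤ k, X j ω ≠ X (k + 1) ω := by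
      intro ω e
      constructor
      · rintro ⟨_, ⟨k, rfl, hk⟩, he⟩
        exact ⟨k, Subtype.ext he, fun j hj h' => hk j hj (congrArg Subtype.val h')⟩
      · rintro ⟨k, rfl, hk⟩
        exact ⟨_, ⟨k, rfl, fun j hj h' => hk j hj (Subtype.ext h')⟩, rfl⟩
    ext ω
    simp only [Set.mem_ofPred_eq, Set.mem_iInter, ← h₃]
    constructor
    · rintro rfl e
      rfl
    · intro h₄
      ext e
      constructor
      · intro he
        obtain ⟨_, ⟨k, rfl, hk⟩, rfl⟩ := id he
        exact (h₄ _).1 he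
      · exact fun he => (h₄ ⟨e, ht he⟩).2 he
  rw [h₂]
  refine MeasurableSet.iInter fun e => ?_
  by_cases he : (e : β) ∈ t
  · simpa only [he, iff_true] using h₁ e
  · simp only [he, iff_false]
    exact (h₁ e).compl

lemma ae_isSpanningTree (h : G.IsWeightedRandomWalk w x P X Y) [IsProbabilityMeasure P]
    (hG : G.Connected) (hw : ∀ e ∈ E(G), 0 < w e) :
    ∀ᵐ ω ∂P, G.IsSpanningTree
      (groundskeeperTree (fun n => (X n ω : α)) (fun n => (Y n ω : β))) := by
  filter_upwards [h.ae_isLink, h.ae_exists_position_eq hG hw] with ω hl hcov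
  obtain ⟨n, hn⟩ := exists_forall_exists_le hcov
  have h₁ := isArborescence_prependWalk (f := fun i => Y i ω) hn hl fun _ => (Y 0 ω, x)
  rw [← arrowEdges_prependWalk hn]
  exact h₁.isSpanningTree

lemma sum_mul_measure_eq (h : G.IsWeightedRandomWalk w x P X Y) [IsProbabilityMeasure P]
    (hE : E(G).Finite) (hG : G.Connected) (hw : ∀ e ∈ E(G), 0 < w e) {t : Set β}
    (ht : G.IsSpanningTree t) :
    (∑ u ∈ (finite_setOf_isSpanningTree hE).toFinset, ENNReal.ofReal (treeWeight w u)) *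
      P {ω | groundskeeperTree (fun n => (X n ω : α)) (fun n => (Y n ω : β)) = t} =
      ENNReal.ofReal (treeWeight w t) := by
  classical
  refine (h.sum_mul_measure_le hE hG hw ht).antisymm ?_
  set S := (finite_setOf_isSpanningTree hE).toFinset with hS
  have hmem : ∀ u, u ∈ S ↔ G.IsSpanningTree u := fun u => by simp [S]
  set Z := ∑ u ∈ S, ENNReal.ofReal (treeWeight w u) with hZ
  set q : Set β → ℝ≥0∞ := fun u =>
    P {ω | groundskeeperTree (fun n => (X n ω : α)) (fun n => (Y n ω : β)) = u} with hq
  have h₁ : ∑ u ∈ S, q u = 1 := by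
    rw [← measure_biUnion_finset
      (fun u _ v _ huv => Set.disjoint_left.2 fun ω hu hv => huv (hu.symm.trans hv))
      (fun u hu => h.measurableSet_groundskeeperTree_eq ((hmem u).1 hu).1), ← measure_univ (μ := P)]
    refine measure_congr (Filter.eventuallyEq_univ.2 ?_)
    filter_upwards [h.ae_isSpanningTree hG hw] with ω hω
    simpa [hmem] using hω
  -- The upper bounds for all trees add up to `Z`, and so do the bounded quantities; cancelling the
  -- finite contribution of the other trees leaves the lower bound for `t`.
  have h₂ : Z = Z * q t + ∑ u ∈ S.erase t, Z * q u := by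
    rw [Finset.add_sum_erase S (fun u => Z * q u) ((hmem t).2 ht), ← Finset.mul_sum, h₁, mul_one]
  have h₃ : ∑ u ∈ S.erase t, Z * q u ≤ ∑ u ∈ S.erase t, ENNReal.ofReal (treeWeight w u) :=
    Finset.sum_le_sum fun u hu =>
      h.sum_mul_measure_le hE hG hw ((hmem u).1 (Finset.mem_of_mem_erase hu))
  have h₄ : ENNReal.ofReal (treeWeight w t) +
      ∑ u ∈ S.erase t, ENNReal.ofReal (treeWeight w u) = Z :=
    Finset.add_sum_erase S (fun u => ENNReal.ofReal (treeWeight w u)) ((hmem t).2 ht)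
  have h₅ : ∑ u ∈ S.erase t, ENNReal.ofReal (treeWeight w u) ≠ ⊤ :=
    ENNReal.sum_ne_top.2 fun u _ => ENNReal.ofReal_ne_top
  refine (ENNReal.add_le_add_iff_right h₅).1 ?_
  rw [h₄]
  exact h₂.le.trans (add_le_add_right h₃ _)

lemma measure_groundskeeperTree_eq (h : G.IsWeightedRandomWalk w x P X Y)
    [IsProbabilityMeasure P] (hE : E(G).Finite) (hG : G.Connected)
    (hw : ∀ e ∈ E(G), 0 < w e) {t : Set β} (ht : G.IsSpanningTree t) :
    P {ω | groundskeeperTree (fun n => (X n ω : α)) (fun n => (Y n ω : β)) = t} =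
      ENNReal.ofReal (G.weightSelectedProb w t) := by
  have hpos : ∀ u ∈ (finite_setOf_isSpanningTree hE).toFinset, 0 < treeWeight w u := fun u hu =>
    treeWeight_pos hE hw (by simpa using hu)
  have h₁ : 0 < ∑ u ∈ (finite_setOf_isSpanningTree hE).toFinset, treeWeight w u :=
    Finset.sum_pos hpos ⟨t, by simpa using ht⟩
  rw [weightSelectedProb, finsum_mem_eq_finite_toFinset_sum _ (finite_setOf_isSpanningTree hE),
    ENNReal.ofReal_div_of_pos h₁, ← h.sum_mul_measure_eq hE hG hw ht,
    ← ENNReal.ofReal_sum_of_nonneg fun u hu => (hpos u hu).le, mul_comm,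
    ENNReal.mul_div_cancel_right (by simpa using h₁) ENNReal.ofReal_ne_top]

end IsWeightedRandomWalk

lemma weightSelectedProb_of_eq_one {w : β → ℝ} (hE : E(G).Finite) (hw : ∀ e ∈ E(G), w e = 1)
    {t : Set β} (ht : G.IsSpanningTree t) :
    ENNReal.ofReal (G.weightSelectedProb w t) =
      1 / ({u : Set β | G.IsSpanningTree u}.ncard : ℝ≥0∞) := by
  have h₁ : ∀ u, G.IsSpanningTree u → treeWeight w u = 1 := fun u hu =>
    finprod_mem_of_eqOn_one fun e he => hw e (hu.1 he)
  have hfin := finite_setOf_isSpanningTree hE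
  have h₂ : 0 < {u : Set β | G.IsSpanningTree u}.ncard := (Set.ncard_pos hfin).2 ⟨t, ht⟩
  rw [weightSelectedProb, h₁ t ht, finsum_mem_congr (t := {u | G.IsSpanningTree u}) rfl h₁,
    finsum_mem_eq_finite_toFinset_sum _ hfin, Finset.sum_const, nsmul_one,
    ← Set.ncard_eq_toFinset_card _ hfin, ENNReal.ofReal_div_of_pos (by exact_mod_cast h₂),
    ENNReal.ofReal_one, ENNReal.ofReal_natCast]

end Graph

end

theorem mainTheorem3 {α β : Type*} (G : Graph α β) (hV : V(G).Finite) (hE : E(G).Finite)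
    (hG : G.Connected) (w : β → ℝ) (hw : ∀ e ∈ E(G), 0 < w e) (x : V(G))
    {Ω : Type*} [MeasurableSpace Ω] (P : MeasureTheory.Measure Ω)
    [MeasureTheory.IsProbabilityMeasure P]
    (X : ℕ → Ω → V(G)) (Y : ℕ → Ω → E(G)) (hXY : G.IsWeightedRandomWalk w x P X Y)
    (T : Ω → Set β)
    (hT : ∀ ω, T ω = Graph.groundskeeperTree (fun n => (X n ω : α)) (fun n => (Y n ω : β))) :
    (∀ᵐ ω ∂P, G.IsSpanningTree (T ω)) ∧
    (∀ t : Set β, G.IsSpanningTree t →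
      MeasurableSet {ω | T ω = t} ∧
      P {ω | T ω = t} = ENNReal.ofReal (G.weightSelectedProb w t)) ∧
    ((∀ e ∈ E(G), w e = 1) → ∀ t : Set β, G.IsSpanningTree t →
      P {ω | T ω = t} = 1 / ({u : Set β | G.IsSpanningTree u}.ncard : ENNReal)) := by
  have := hV.fintype
  have := hE.fintype
  simp only [hT]
  refine ⟨hXY.ae_isSpanningTree hG hw, fun t ht => ⟨hXY.measurableSet_groundskeeperTree_eq ht.1,
    hXY.measure_groundskeeperTree_eq hE hG hw ht⟩, fun hw₁ t ht => ?_⟩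
  rw [hXY.measure_groundskeeperTree_eq hE hG hw ht, Graph.weightSelectedProb_of_eq_one hE hw₁ ht]
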